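/- A topological space is called *standard* if it is locally compact, separable and metrizable. Let $q:Y\to X$ be a quotient map from a standard space $Y$ onto a Hausdorff space $X$. For a topological space $Z$ let ${\rm Cl}(Z)$ be the set of all closed subsets of $Z$ (including $\emptyset$) with the Fell topology, a subbase of which consists of the sets $\{F: F\cap K=\emptyset\}$ ($K\subseteq Z$ compact) and $\{F: F\cap U\neq\emptyset\}$ ($U\subseteq Z$ open). A sequence $(F_n)$ in ${\rm Cl}(Z)$ converges to $\infty$ in the Fell topology, written $F_n\to\infty$, if it converges to $\emptyset$ in ${\rm Cl}(Z)$, i.e. if every compact subset of $Z$ is disjoint from $F_n$ for all sufficiently large $n$. Let $Y_*$ be the space of all non-empty elements of the closure in ${\rm Cl}(Y)$ of the set of fibres $\{q^{-1}(x): x\in X\}$, with the subspace topology, and let $q_*:Y_*\to X$ be the (well-defined, continuous) map $q_*(F)=q(y)$ for $y\in F$. Order $Y_*$ by $F\le G$ if and only if $G\subseteq F$. Let $V$ be the closure in $Y_*$ of the set of maximal elements of $Y_*$, and let $p=q_*|_V:V\to X$. A point $x\in X$ is of *compact type* if there is a compact set $K\subseteq X$ such that every sequence in $X$ converging to $x$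 is eventually in $K$. **Theorem 4.10.** Suppose that the set $E$ of points of compact type is sequentially dense in $X$, i.e. every point of $X$ is the limit of a sequence of points of $E$. Then $p$ is a quotient map onto $X$ if and only if, for every convergent sequence $(x_n)$ in $X$, the sequence of closed sets $p^{-1}(x_n)\in{\rm Cl}(V)$ does not converge to $\infty$ in the Fell topology. -/

import Mathlib

open Filter Topology

namespace FellQuot

/-- `Cl Y`: the set of all closed subsets of `Y`, the empty set included.  (A type of its own, so
that no other topology or order on closed sets interferes.) -/
@[ext]
structure Cl (Y : Type*) [TopologicalSpace Y] where
  carrier : Set Y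
  isClosed : IsClosed carrier

/-- The Fell topology on `Cl Y`: a subbase consists of the sets of closed `F` missing a given
compact set, and the sets of closed `F` meeting a given open set. -/
instance Cl.fellTopology (Y : Type*) [TopologicalSpace Y] : TopologicalSpace (Cl Y) :=
  TopologicalSpace.generateFrom
    ({S | ∃ K : Set Y, IsCompact K ∧ S = {F : Cl Y | F.carrier ∩ K = ∅}} ∪
     {S | ∃ U : Set Y, IsOpen U ∧ S = {F : Cl Y | (F.carrier ∩ U).Nonempty}})

/-- The order by inverse inclusion: `F ≤ G` when `G` is a subset of `F`. -/
instance Cl.partialOrder (Y : Type*) [TopologicalSpace Y] : PartialOrder (Cl Y) where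
  le F G := G.carrier ⊆ F.carrier
  le_refl _ := Set.Subset.rfl
  le_trans _ _ _ h₁ h₂ := Set.Subset.trans h₂ h₁
  le_antisymm _ _ h₁ h₂ := Cl.ext (Set.Subset.antisymm h₂ h₁)

/-- The empty closed set. It plays the role of the point at infinity of `Cl Y`. -/
def Cl.empty (Y : Type*) [TopologicalSpace Y] : Cl Y := ⟨∅, isClosed_empty⟩

/-- A sequence of closed sets converges to infinity in the Fell topology if it converges to the
empty set, that is, if it eventually misses every compact set. -/
def TendstoInfty {Y : Type*} [TopologicalSpace Y] (F : ℕ → Cl Y) : Prop :=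
  Tendsto F atTop (𝓝 (Cl.empty Y))

/-- A point `x` is of compact type if some compact set eventually contains every sequence
converging to `x`. -/
def IsCompactType {X : Type*} [TopologicalSpace X] (x : X) : Prop :=
  ∃ K : Set X, IsCompact K ∧
    ∀ u : ℕ → X, Tendsto u atTop (𝓝 x) → ∀ᶠ n in atTop, u n ∈ K

section

variable {Y X : Type*} [TopologicalSpace Y] [TopologicalSpace X]

/-- The set of fibres of `q`, as a subset of `Cl Y`. -/
def fibres (q : Y → X) : Set (Cl Y) := {F | ∃ x ∈ Set.range q, F.carrier = q ⁻¹' {x}}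

/-- The space `Y_*`: all nonempty closed subsets of `Y` that lie in the closure of the set of
fibres of `q` in the Fell topology. -/
def YStar (q : Y → X) : Set (Cl Y) := {F | F ∈ closure (fibres q) ∧ F.carrier.Nonempty}

/-- The map `q_* : Y_* → X`, sending `F` to the value of `q` at the points of `F`. -/
noncomputable def qStar (q : Y → X) (F : YStar q) : X := q F.2.2.some

/-- The closure `V` in `Y_*` of the set of maximal elements of `Y_*`. -/
def maxClosure (q : Y → X) : Set (YStar q) := closure {F : YStar q | IsMax F}

/-- The restriction `p` of `q_*` to `V`. -/
noncomputable def pMap (q : Y → X) (v : maxClosure q) : X := qStar q v.1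

theorem isOpen_hits {U : Set Y} (hU : IsOpen U) :
    IsOpen {F : Cl Y | (F.carrier ∩ U).Nonempty} :=
  TopologicalSpace.isOpen_generateFrom_of_mem (Or.inr ⟨U, hU, rfl⟩)

variable [T2Space X]

/-- `q_*` is well defined: `q` is constant on each element of `Y_*`. -/
theorem qStar_eq {q : Y → X} (hq : Continuous q) (F : YStar q) {y : Y}
    (hy : y ∈ F.1.carrier) : qStar q F = q y := by
  by_contra hne
  obtain ⟨A, B, hA, hB, ha, hb, hAB⟩ := t2_separation hne
  have hopen := (isOpen_hits (hA.preimage hq)).inter (isOpen_hits (hB.preimage hq))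
  obtain ⟨G, ⟨⟨a, haG, haA⟩, ⟨b, hbG, hbB⟩⟩, x, -, hG⟩ :=
    mem_closure_iff.1 F.2.1 _ hopen
      ⟨⟨F.2.2.some, F.2.2.some_mem, ha⟩, ⟨y, hy, hb⟩⟩
  rw [hG] at haG hbG
  have h₁ : q a = x := haG
  have h₂ : q b = x := hbG
  have h₃ : x ∈ A := h₁ ▸ haA
  have h₄ : x ∈ B := h₂ ▸ hbB
  exact Set.disjoint_left.1 hAB h₃ h₄

theorem continuous_qStar {q : Y → X} (hq : Continuous q) : Continuous (qStar q) := by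
  refine continuous_def.2 fun W hW => ?_
  have : qStar q ⁻¹' W =
      Subtype.val ⁻¹' {F : Cl Y | (F.carrier ∩ q ⁻¹' W).Nonempty} := by
    ext F
    constructor
    · intro h
      exact ⟨F.2.2.some, F.2.2.some_mem, h⟩
    · rintro ⟨y, hy, hW'⟩
      have h := qStar_eq hq F hy
      change qStar q F ∈ W
      rw [h]
      exact hW'
  rw [this]
  exact (isOpen_hits (hW.preimage hq)).preimage continuous_subtype_val

theorem continuous_pMap {q : Y → X} (hq : Continuous q) : Continuous (pMap q) :=
  (continuous_qStar hq).comp continuous_subtype_val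

/-- The fibre of `p` over `x`, as a (possibly empty) closed subset of `V`. -/
noncomputable def pFibre {q : Y → X} (hq : Continuous q) (x : X) : Cl (maxClosure q) :=
  ⟨pMap q ⁻¹' {x}, isClosed_singleton.preimage (continuous_pMap hq)⟩

end

end FellQuot

namespace FellQuot

section FellTopology

variable {Y : Type*} [TopologicalSpace Y]

/-! The criterion holds for `p` because `V` is locally compact and `X` is sequential and Hausdorff.
If the fibres over `x n` leave every compact set, local compactness makes them a locally finite
family, so a quotient map would make the set of terms other than the limit closed, which is absurd.
Conversely, a compact set meeting infinitely many of the fibres has compact image under `p`, and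
this image captures the limit. -/

theorem isOpen_misses {K : Set Y} (hK : IsCompact K) :
    IsOpen {F : Cl Y | F.carrier ∩ K = ∅} :=
  TopologicalSpace.isOpen_generateFrom_of_mem (Or.inl ⟨K, hK, rfl⟩)

/-- Convergence to infinity means eventually missing every compact set. -/
theorem tendstoInfty_iff {F : ℕ → Cl Y} :
    TendstoInfty F ↔ ∀ K : Set Y, IsCompact K → ∀ᶠ n in atTop, (F n).carrier ∩ K = ∅ := by
  constructor
  · intro h K hK
    exact h.eventually ((isOpen_misses hK).mem_nhds (Set.empty_inter K))
  · intro h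
    refine TopologicalSpace.tendsto_nhds_generateFrom_iff.2 ?_
    rintro s (⟨K, hK, rfl⟩ | ⟨U, -, rfl⟩) hs
    · exact h K hK
    · obtain ⟨y, hy, -⟩ := hs
      exact absurd hy (Set.notMem_empty y)

/-- The Fell topology is compact. -/
instance Cl.compactSpace : CompactSpace (Cl Y) := by
  refine compactSpace_generateFrom rfl fun P hP hcover => ?_
  -- By Alexander's subbase theorem only subbasic covers matter. The complement of `W` hits no `U ∈
  -- 𝒰`, so a set of the form "misses `K`" must cover it. Then `K ⊆ W`, and finitely many `U` cover
  -- `K`.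
  let 𝒰 : Set (Set Y) := {U | IsOpen U ∧ {F : Cl Y | (F.carrier ∩ U).Nonempty} ∈ P}
  let W : Set Y := ⋃₀ 𝒰
  have hW : IsOpen W := isOpen_sUnion fun U hU => hU.1
  obtain ⟨S, hSP, hS⟩ : (⟨Wᶜ, hW.isClosed_compl⟩ : Cl Y) ∈ ⋃₀ P := hcover ▸ Set.mem_univ _
  rcases hP hSP with ⟨K, hK, rfl⟩ | ⟨U, hU, rfl⟩
  · have hKW : K ⊆ W := fun y hy => by
      by_contra hyW
      exact Set.notMem_empty y ((show Wᶜ ∩ K = ∅ from hS) ▸ ⟨hyW, hy⟩)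
    obtain ⟨T, hT, hTfin, hKT⟩ := hK.elim_finite_subcover_image (b := 𝒰) (c := id)
      (fun U hU => hU.1) (hKW.trans Set.sUnion_eq_biUnion.subset)
    refine ⟨insert {F : Cl Y | F.carrier ∩ K = ∅}
      ((fun U : Set Y => {F : Cl Y | (F.carrier ∩ U).Nonempty}) '' T), ?_,
      (hTfin.image _).insert _, ?_⟩
    · rintro _ (rfl | ⟨U, hU, rfl⟩)
      · exact hSP
      · exact (hT hU).2
    · refine Set.eq_univ_of_forall fun F => ?_
      rcases (F.carrier ∩ K).eq_empty_or_nonempty with h | ⟨y, hyF, hyK⟩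
      · exact ⟨_, Set.mem_insert _ _, h⟩
      · obtain ⟨U, hUT, hyU⟩ := Set.mem_iUnion₂.1 (hKT hyK)
        exact ⟨_, Set.mem_insert_of_mem _ ⟨U, hUT, rfl⟩, y, hyF, hyU⟩
  · obtain ⟨y, hyW, hyU⟩ := hS
    exact absurd ⟨U, ⟨hU, hSP⟩, hyU⟩ hyW

/-- The Fell topology of a locally compact space is Hausdorff. -/
instance Cl.t2Space [LocallyCompactSpace Y] : T2Space (Cl Y) := by
  have key : ∀ F G : Cl Y, ¬ F.carrier ⊆ G.carrier → ∃ A B : Set (Cl Y),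
      IsOpen A ∧ IsOpen B ∧ F ∈ A ∧ G ∈ B ∧ Disjoint A B := by
    intro F G h
    obtain ⟨y, hyF, hyG⟩ := Set.not_subset.1 h
    obtain ⟨K, hK, hyK, hKG⟩ := exists_compact_subset G.isClosed.isOpen_compl hyG
    refine ⟨_, _, isOpen_hits isOpen_interior, isOpen_misses hK, ⟨y, hyF, hyK⟩, ?_, ?_⟩
    · exact Set.eq_empty_of_forall_notMem fun z hz => hKG hz.2 hz.1
    · refine Set.disjoint_left.2 fun H hH hH' => ?_
      obtain ⟨z, hz, hzK⟩ := hH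
      exact Set.notMem_empty z ((show H.carrier ∩ K = ∅ from hH') ▸ ⟨hz, interior_subset hzK⟩)
  refine ⟨fun F G hne => ?_⟩
  by_cases h : F.carrier ⊆ G.carrier
  · obtain ⟨A, B, hA, hB, hGA, hFB, hAB⟩ :=
      key G F fun h' => hne (Cl.ext (Set.Subset.antisymm h h'))
    exact ⟨B, A, hB, hA, hFB, hGA, hAB.symm⟩
  · exact key F G h

/-- A closed set intersected with an open one in the compact Hausdorff space `Cl Y`. -/
instance YStar.locallyCompactSpace [LocallyCompactSpace Y] {X : Type*} (q : Y → X) :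
    LocallyCompactSpace (YStar q) := by
  have hopen : IsOpen {F : Cl Y | F.carrier.Nonempty} := by
    simpa only [Set.inter_univ] using isOpen_hits (Y := Y) isOpen_univ
  exact (isClosed_closure.isLocallyClosed.inter hopen.isLocallyClosed).locallyCompactSpace

instance maxClosure.locallyCompactSpace [LocallyCompactSpace Y] {X : Type*} (q : Y → X) :
    LocallyCompactSpace (maxClosure q) :=
  isClosed_closure.isLocallyClosed.locallyCompactSpace

end FellTopology

/-- Fibres of a quotient map from a locally compact space over the terms of a convergent sequence
do not eventually leave every compact set. -/
theorem not_eventually_fibre_inter_eq_empty {V X : Type*} [TopologicalSpace V]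
    [LocallyCompactSpace V] [TopologicalSpace X] [T1Space X] {p : V → X} (hp : IsQuotientMap p)
    {x : ℕ → X} {x₀ : X} (hx : Tendsto x atTop (𝓝 x₀)) :
    ¬ ∀ K : Set V, IsCompact K → ∀ᶠ n in atTop, p ⁻¹' {x n} ∩ K = ∅ := by
  intro h
  -- Indices with `x n = x₀` are dropped so that the closed set built below omits `x₀`.
  have hlf : LocallyFinite fun n : {n // x n ≠ x₀} => p ⁻¹' {x n} := by
    refine LocallyFinite.comp_injective (f := fun n => p ⁻¹' {x n}) (fun v => ?_)
      Subtype.val_injective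
    obtain ⟨K, hK, hvK⟩ := exists_compact_mem_nhds v
    refine ⟨K, hvK, ?_⟩
    have hfin := Filter.eventually_cofinite.1 (Nat.cofinite_eq_atTop ▸ h K hK)
    simpa only [← Set.nonempty_iff_ne_empty, ← ne_eq] using hfin
  have hclosed : IsClosed (⋃ n : {n // x n ≠ x₀}, {x n}) := by
    refine hp.isClosed_preimage.1 ?_
    rw [Set.preimage_iUnion]
    exact hlf.isClosed_iUnion fun n => isClosed_singleton.preimage hp.continuous
  have hx₀ : x₀ ∉ ⋃ n : {n // x n ≠ x₀}, {x n} := by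
    intro hmem
    obtain ⟨n, hn⟩ := Set.mem_iUnion.1 hmem
    exact n.2 hn.symm
  obtain ⟨v, hv⟩ := hp.surjective x₀
  -- Eventually `x n = x₀`, yet its fibre must miss the point `v` lying over `x₀`.
  obtain ⟨n, hn, hnv⟩ :=
    ((hx.eventually (hclosed.isOpen_compl.mem_nhds hx₀)).and (h {v} isCompact_singleton)).exists
  have hxn : x n = x₀ := by
    by_contra hne
    exact hn (Set.mem_iUnion.2 ⟨⟨n, hne⟩, rfl⟩)
  exact Set.notMem_empty v (hnv ▸ ⟨hv.trans hxn.symm, rfl⟩)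

/-- A continuous map to a sequential Hausdorff space is a quotient map if its fibres over the terms
of a convergent sequence never eventually leave every compact set. -/
theorem isQuotientMap_of_frequently_fibre_inter_nonempty {V X : Type*} [TopologicalSpace V]
    [TopologicalSpace X] [T2Space X] [SequentialSpace X] {p : V → X} (hp : Continuous p)
    (h : ∀ (x : ℕ → X) (x₀ : X), Tendsto x atTop (𝓝 x₀) →
      ∃ K : Set V, IsCompact K ∧ ∃ᶠ n in atTop, (p ⁻¹' {x n} ∩ K).Nonempty) :
    IsQuotientMap p := by
  refine isQuotientMap_iff_isClosed.2 ⟨fun x => ?_, fun C => ⟨fun hC => hC.preimage hp,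
    fun hC => ?_⟩⟩
  -- Constant sequences give surjectivity.
  · obtain ⟨K, -, hK⟩ := h (fun _ => x) x tendsto_const_nhds
    obtain ⟨-, v, hv, -⟩ := hK.exists
    exact ⟨v, hv⟩
  · refine IsSeqClosed.isClosed fun x x₀ hxC hx => ?_
    obtain ⟨K, hK, hfreq⟩ := h x x₀ hx
    have himage : IsClosed (p '' (K ∩ p ⁻¹' C)) := ((hK.inter_right hC).image hp).isClosed
    have hmem : x₀ ∈ p '' (K ∩ p ⁻¹' C) := by
      refine himage.mem_of_frequently_of_tendsto (hfreq.mono fun n hn => ?_) hx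
      obtain ⟨v, hv, hvK⟩ := hn
      have hpv : p v = x n := hv
      exact ⟨v, ⟨hvK, by simpa only [Set.mem_preimage, hpv] using hxC n⟩, hpv⟩
    obtain ⟨v, ⟨-, hvC⟩, rfl⟩ := hmem
    exact hvC

end FellQuot

theorem theorem4p10 {Y X : Type*} [TopologicalSpace Y] [LocallyCompactSpace Y]
    [TopologicalSpace.MetrizableSpace Y] [TopologicalSpace.SeparableSpace Y]
    [TopologicalSpace X] [T2Space X] (q : Y → X) (hq : IsQuotientMap q)
    (hE : seqClosure {x : X | FellQuot.IsCompactType x} = Set.univ) :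
    IsQuotientMap (FellQuot.pMap q) ↔
      ∀ (x : ℕ → X) (x₀ : X), Tendsto x atTop (𝓝 x₀) →
        ¬ FellQuot.TendstoInfty (fun n => FellQuot.pFibre hq.continuous (x n)) := by
  constructor
  · intro hp x x₀ hx hinf
    exact FellQuot.not_eventually_fibre_inter_eq_empty hp hx (FellQuot.tendstoInfty_iff.1 hinf)
  · intro h
    -- Sequentiality passes from the metrizable space `Y` to its quotient.
    have : SequentialSpace X := hq.sequentialSpace
    refine FellQuot.isQuotientMap_of_frequently_fibre_inter_nonempty
      (FellQuot.continuous_pMap hq.continuous) fun x x₀ hx => ?_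
    by_contra! hcon
    refine h x x₀ hx (FellQuot.tendstoInfty_iff.2 fun K hK => ?_)
    exact hcon K hK
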